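/- Fix a set $I$ of variables. A \emph{word} over $I$ is a bracketed tensor expression built from variables $i\in I$ (repetitions allowed), a unit symbol $e$, and a binary product $s\otimes t$; its \emph{length} is the number of occurrences of variables in it. In a monoidal category $\mathcal C$, each word $w$ defines a functor $w_{\mathcal C}:\prod_{i\in I}\mathcal C\to\mathcal C$ (a variable is sent to a projection, $e$ to the constant functor at the monoidal unit, and $\otimes$ to the pointwise tensor product). A \emph{formal structural isomorphism} $f:s\to t$ between words is a formal expression built by composition, inversion and $\otimes$ from identities, associators $(s\otimes t)\otimes u\to s\otimes(t\otimes u)$, unitors $e\otimes s\to s$, $s\otimes e\to s$, and commutators $s\otimes t\to t\otimes s$. If $\mathcal C$ is braided monoidal, $f$ defines a natural isomorphism $f_{\mathcal C}:s_{\mathcal C}\Rightarrow t_{\mathcal C}$ by interpreting these as the associator, unitors and braiding of $\mathcal C$. If $s$ (and hence $t$) has length $n$, then $f$ has an \emph{underlying braid} in the braid group $B_n$ (with Artin generators $\sigma_1,\dots,\sigma_{n-1}$): identities, associators and unitors have trivial braid; composites and inverses go to composites and inverses; $f\otimes g$ goes to the juxtaposition of the two braids; and the commutator $s\otimes t\to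 t\otimes s$ goes to the positive crossing of the block of the first $\mathrm{length}(s)$ strands with the block of the last $\mathrm{length}(t)$ strands. Likewise $f$ has an \emph{underlying permutation}, the bijection from the occurrences of variables in $s$ to those in $t$ that is defined in the same way, the commutator $s\otimes t\to t\otimes s$ giving the exchange of the two blocks. \textbf{Theorem (Mac Lane's coherence theorems).} \begin{enumerate} \item Let $\mathcal C$ be a braided monoidal category, and let $f,g:s\to t$ be formal structural isomorphisms between the same two words. If $f$ and $g$ have the same underlying braid, then $f_{\mathcal C}=g_{\mathcal C}$. \item Let $\mathcal C$ be a symmetric monoidal category, and let $f,g:s\to t$ be formal structural isomorphisms between the same two words. If $f$ and $g$ have the same underlying permutation, then $f_{\mathcal C}=g_{\mathcal C}$. \end{enumerate} -/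

import Mathlib

open CategoryTheory MonoidalCategory

namespace BraidCoherence

/-! ### The braid groups, by Artin's presentation -/

/-- Artin's relations between the generators `σ₀, …, σ_{n-2}` of the braid group on `n` strands. -/
def artinRels (n : ℕ) : Set (FreeGroup (Fin (n - 1))) :=
  {r | ∃ i j : Fin (n - 1), (i : ℕ) + 2 ≤ j ∧
      r = (.of i * .of j) * (.of j * .of i)⁻¹} ∪
  {r | ∃ i j : Fin (n - 1), (i : ℕ) + 1 = j ∧
      r = (.of i * .of j * .of i) * (.of j * .of i * .of j)⁻¹}

/-- The braid group `B_n` on `n` strands. -/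
abbrev BraidGroup (n : ℕ) : Type := PresentedGroup (artinRels n)

namespace BraidGroup

/-- The generator `σ_i` of `B_n`: the strands in positions `i` and `i + 1` (counted from `0`)
cross. A product `a * b` of braids means: first `a`, then `b`. -/
def σ {n : ℕ} (i : Fin (n - 1)) : BraidGroup n := PresentedGroup.of i

theorem σ_comm {n : ℕ} (i j : Fin (n - 1)) (h : (i : ℕ) + 2 ≤ j) : σ i * σ j = σ j * σ i := by
  have := PresentedGroup.one_of_mem (rels := artinRels n)
    (x := (.of i * .of j) * (.of j * .of i)⁻¹) (Or.inl ⟨i, j, h, rfl⟩)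
  simp only [map_mul, map_inv] at this
  exact mul_inv_eq_one.mp this

theorem σ_braid {n : ℕ} (i j : Fin (n - 1)) (h : (i : ℕ) + 1 = j) :
    σ i * σ j * σ i = σ j * σ i * σ j := by
  have := PresentedGroup.one_of_mem (rels := artinRels n)
    (x := (.of i * .of j * .of i) * (.of j * .of i * .of j)⁻¹) (Or.inr ⟨i, j, h, rfl⟩)
  simp only [map_mul, map_inv] at this
  exact mul_inv_eq_one.mp this

/-- The homomorphism `B_m → B_n`, `σ_i ↦ σ_{k+i}`, that places a braid on `m` strands on the
positions `k, …, k + m - 1` among `n` strands. -/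
def place (k m n : ℕ) (h : k + m ≤ n) : BraidGroup m →* BraidGroup n :=
  PresentedGroup.toGroup
    (f := fun i : Fin (m - 1) => (σ ⟨k + i, by have := i.isLt; omega⟩ : BraidGroup n)) (by
      rintro r (⟨i, j, hij, rfl⟩ | ⟨i, j, hij, rfl⟩)
      · simp only [map_mul, map_inv, FreeGroup.lift_apply_of]
        exact mul_inv_eq_one.mpr (σ_comm _ _ (by simp only; omega))
      · simp only [map_mul, map_inv, FreeGroup.lift_apply_of]
        exact mul_inv_eq_one.mpr (σ_braid _ _ (by simp only; omega)))

/-- The block crossing in `B_n`, `n = p + q`: the first `p` strands, as a block, cross the last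
`q` strands by positive crossings. It is the product, over `i = 0, …, p - 1`, of
`σ_{p-1-i} σ_{p-i} ⋯ σ_{p-1-i+q-1}`: strand `p - 1 - i` crosses the `q` strands one by one. -/
def cross (p q n : ℕ) (h : p + q = n) : BraidGroup n :=
  (List.ofFn fun i : Fin p =>
    (List.ofFn fun j : Fin q =>
      (σ ⟨p - 1 - i + j, by have := i.isLt; have := j.isLt; omega⟩ : BraidGroup n)).prod).prod

end BraidGroup

/-! ### Formal tensor words and formal structural isomorphisms -/

/-- Bracketed tensor words, with units, in variables from `ι`. -/
inductive Word.{w} (ι : Type w) : Type w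
  | unit : Word ι
  | var (i : ι) : Word ι
  | tensor (s t : Word ι) : Word ι

namespace Word

universe w
variable {ι : Type w}

/-- The number of occurrences of variables in a word. -/
def length : Word ι → ℕ
  | unit => 0
  | var _ => 1
  | tensor s t => s.length + t.length

/-- The type of occurrences of variables in a word. -/
def Pos : Word ι → Type
  | unit => Empty
  | var _ => Unit
  | tensor s t => s.Pos ⊕ t.Pos

/-- The functor `(X_i)_i ↦ w(X)` that a word defines on a monoidal category `C`; the functor
category carries the pointwise tensor product of Mathlib. -/
def functor (C : Type*) [Category C] [MonoidalCategory C] : Word ι → ((ι → C) ⥤ C)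
  | unit => 𝟙_ ((ι → C) ⥤ C)
  | var i => Pi.eval (fun _ => C) i
  | tensor s t => s.functor C ⊗ t.functor C

end Word

/-- Formal structural isomorphisms between words: all formal composites, inverses and tensor
products of identities, associators, unitors and commutators. -/
inductive Struct.{w} {ι : Type w} : Word ι → Word ι → Type w
  | id (s : Word ι) : Struct s s
  | comp {s t u : Word ι} (f : Struct s t) (g : Struct t u) : Struct s u
  | inv {s t : Word ι} (f : Struct s t) : Struct t s
  | tensor {s t s' t' : Word ι} (f : Struct s t) (g : Struct s' t') :
      Struct (.tensor s s') (.tensor t t')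
  | assoc (s t u : Word ι) : Struct (.tensor (.tensor s t) u) (.tensor s (.tensor t u))
  | leftUnitor (s : Word ι) : Struct (.tensor .unit s) s
  | rightUnitor (s : Word ι) : Struct (.tensor s .unit) s
  | braiding (s t : Word ι) : Struct (.tensor s t) (.tensor t s)

namespace Struct

universe w
variable {ι : Type w}

theorem length_eq {s t : Word ι} (f : Struct s t) : s.length = t.length := by
  induction f with
  | id => rfl
  | comp _ _ hf hg => exact hf.trans hg
  | inv _ hf => exact hf.symm
  | tensor _ _ hf hg => exact congrArg₂ (· + ·) hf hg
  | assoc s t u => exact Nat.add_assoc _ _ _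
  | leftUnitor s => exact Nat.zero_add _
  | rightUnitor s => rfl
  | braiding s t => exact Nat.add_comm _ _

/-- The braid underlying a formal structural isomorphism, on a number `n` of strands which is
given together with a proof that it is the length of the source. -/
def braidAt (n : ℕ) : {s t : Word ι} → Struct s t → s.length = n → BraidGroup n
  | _, _, .id _, _ => 1
  | _, _, .comp f g, h => f.braidAt n h * g.braidAt n (f.length_eq.symm.trans h)
  | _, _, .inv f, h => (f.braidAt n (f.length_eq.trans h))⁻¹
  | _, _, .tensor (s := s) (s' := s') f g, h =>
      BraidGroup.place 0 s.length n (by simp only [Word.length] at h; omega)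
          (f.braidAt s.length rfl) *
        BraidGroup.place s.length s'.length n (by simp only [Word.length] at h; omega)
          (g.braidAt s'.length rfl)
  | _, _, .assoc _ _ _, _ => 1
  | _, _, .leftUnitor _, _ => 1
  | _, _, .rightUnitor _, _ => 1
  | _, _, .braiding s t, h => BraidGroup.cross s.length t.length n h

/-- The underlying braid of a formal structural isomorphism. -/
def braid {s t : Word ι} (f : Struct s t) : BraidGroup s.length := f.braidAt s.length rfl

/-- The underlying permutation of a formal structural isomorphism: the bijection from the
occurrences of variables in the source to those in the target. -/
def perm : {s t : Word ι} → Struct s t → (s.Pos ≃ t.Pos)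
  | _, _, .id s => Equiv.refl s.Pos
  | _, _, .comp f g => f.perm.trans g.perm
  | _, _, .inv f => f.perm.symm
  | _, _, .tensor f g => Equiv.sumCongr f.perm g.perm
  | _, _, .assoc s t u => Equiv.sumAssoc s.Pos t.Pos u.Pos
  | _, _, .leftUnitor s => Equiv.emptySum Empty s.Pos
  | _, _, .rightUnitor s => Equiv.sumEmpty s.Pos Empty
  | _, _, .braiding s t => Equiv.sumComm s.Pos t.Pos

/-- The natural isomorphism that a formal structural isomorphism defines on a braided monoidal
category `C`. -/
def natIso (C : Type*) [Category C] [MonoidalCategory C] [BraidedCategory C] :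
    {s t : Word ι} → Struct s t → (s.functor C ≅ t.functor C)
  | _, _, .id s => Iso.refl (s.functor C)
  | _, _, .comp f g => f.natIso C ≪≫ g.natIso C
  | _, _, .inv f => (f.natIso C).symm
  | _, _, .tensor f g => f.natIso C ⊗ᵢ g.natIso C
  | _, _, .assoc s t u => α_ (s.functor C) (t.functor C) (u.functor C)
  | _, _, .leftUnitor s => λ_ (s.functor C)
  | _, _, .rightUnitor s => ρ_ (s.functor C)
  | _, _, .braiding s t => β_ (s.functor C) (t.functor C)

end Struct

end BraidCoherence

/-!
A formal structural isomorphism has a value `Struct.ev` at a single object `Y` of a braided category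
`E`, substituted for all variables. Two ideas prove both coherence theorems.

*One object.* The free monoidal category on one generator is thin, so two words of the same length
`n` have canonically isomorphic values at `Y` (`Word.can`), in particular a value canonically
isomorphic to the right-bracketed tensor power. The braid group acts on this power
(`Word.actHom`): the Artin relations hold by naturality of the braiding and by the Yang-Baxter
equation. By induction on `f`, its value at `Y` is the action of its underlying braid, up to
canonical isomorphisms (`Struct.represents_braidAt`). The commutators are the only case that is not
formal: the hexagons decompose them in the same way as the block crossings are decomposed into
generators (`Represents.braiding`). So the underlying braid determines the value at `Y`.

In a symmetric category the action kills the normal subgroup `squares n` generated by the squares of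
the generators. A normal form for braids modulo this subgroup (`BraidGroup.exists_normalForm`) shows
that it contains every braid that acts trivially on the powers of `Bool` in the category of types
(`Word.mem_squares_of_actBool`). There a formal structural isomorphism acts by its underlying
permutation (`Struct.coords_perm`), so the underlying permutation determines the value at every
object of every symmetric category (`Struct.ev_eq_of_perm_eq`).

*Several variables.* The formal coproducts of objects of a braided or symmetric category `D` form
again such a category, with `⊗` distributing over coproducts. For `D` the category of functors
`(ι → C) ⥤ C` and `Y` the formal coproduct of the projections, the functor of a word in several
variables is a summand of the value of the word at `Y`, naturally with respect to formal structural
isomorphisms (`map_natIso_comp_summand`). So the values at this one object `Y` determine the natural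
isomorphisms (`natIso_eq_of_ev_eq`).
-/

namespace BraidCoherence

universe w v u

/-! ### Words in one object and coherence for monoidal categories -/

namespace Word

/-- The right-bracketed word with `n` letters, all equal. -/
@[reducible] def pow : ℕ → Word PUnit.{1}
  | 0 => .unit
  | n + 1 => .tensor (.var ⟨⟩) (pow n)

@[simp] theorem length_pow (n : ℕ) : (pow n).length = n := by
  induction n with
  | zero => rfl
  | succ n ih => simp only [length, ih]; omega

variable {ι κ μ : Type*}

@[simp] theorem length_tensor (a b : Word ι) : (a.tensor b).length = a.length + b.length := rfl

/-- The object of the free monoidal category on one generator with the bracketing of the word. All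
variables become the generator. -/
def toFree : Word ι → FreeMonoidalCategory PUnit.{1}
  | var _ => .of ⟨⟩
  | unit => .unit
  | tensor a b => .tensor a.toFree b.toFree

/-- The rebracketing of `pow m ⊗ pow k` in the free monoidal category. Which isomorphism is chosen
does not matter, since the free monoidal category is thin. -/
def powAddIso : (m k : ℕ) → (((pow m).tensor (pow k)).toFree ≅ (pow (m + k)).toFree)
  | 0, k => λ_ (pow k).toFree ≪≫ eqToIso (by rw [Nat.zero_add])
  | m + 1, k => α_ (.of ⟨⟩) (pow m).toFree (pow k).toFree ≪≫
      whiskerLeftIso (.of ⟨⟩) (powAddIso m k) ≪≫ eqToIso (by rw [Nat.add_right_comm]; rfl)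

/-- The isomorphism in the free monoidal category that removes the units from a word and moves its
brackets to the right. -/
def powIso : (a : Word ι) → (a.toFree ≅ (pow a.length).toFree)
  | var _ => (ρ_ _).symm
  | unit => Iso.refl _
  | tensor a b => (a.powIso ⊗ᵢ b.powIso) ≪≫ powAddIso a.length b.length

/-- The isomorphism in the free monoidal category between two words of the same length. -/
def freeIso {a : Word ι} {b : Word κ} (h : a.length = b.length) : a.toFree ≅ b.toFree :=
  a.powIso ≪≫ eqToIso (congrArg (fun n => (pow n).toFree) h) ≪≫ b.powIso.symm

variable {E : Type u} [Category.{v} E] [MonoidalCategory E] (Y : E)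

/-- The value of a word at a single object `Y`, substituted for all variables. It is reducible, so
that the value of a tensor product of words is seen to be a tensor product. -/
@[reducible] def ev : Word ι → E
  | var _ => Y
  | unit => 𝟙_ E
  | tensor a b => ev a ⊗ ev b

/-- The value of a word computed directly and through the free monoidal category. -/
def evIso : (a : Word ι) → (ev Y a ≅ (FreeMonoidalCategory.project fun _ => Y).obj a.toFree)
  | var _ => Iso.refl _
  | unit => Iso.refl _
  | tensor a b => evIso a ⊗ᵢ evIso b

/-- The interpretation at `Y` of a morphism of the free monoidal category. -/
def evMap {a : Word ι} {b : Word κ} (f : a.toFree ⟶ b.toFree) : ev Y a ⟶ ev Y b :=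
  (evIso Y a).hom ≫ (FreeMonoidalCategory.project fun _ => Y).map f ≫ (evIso Y b).inv

theorem evMap_id (a : Word ι) : evMap Y (𝟙 a.toFree) = 𝟙 (ev Y a) := by
  simp [evMap]

theorem evMap_comp {a : Word ι} {b : Word κ} {c : Word μ} (f : a.toFree ⟶ b.toFree)
    (g : b.toFree ⟶ c.toFree) : evMap Y (f ≫ g) = evMap Y f ≫ evMap Y g := by
  simp [evMap]

/-- The canonical isomorphism between the values at `Y` of two words of the same length. -/
def can {a : Word ι} {b : Word κ} (h : a.length = b.length) : ev Y a ≅ ev Y b where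
  hom := evMap Y (freeIso h).hom
  inv := evMap Y (freeIso h).inv
  hom_inv_id := by rw [← evMap_comp, Iso.hom_inv_id, evMap_id]
  inv_hom_id := by rw [← evMap_comp, Iso.inv_hom_id, evMap_id]

/-- All morphisms of the free monoidal category are interpreted by the canonical isomorphisms:
this is coherence for monoidal categories, the free monoidal category being thin. -/
theorem can_eq {a : Word ι} {b : Word κ} (h : a.length = b.length) (f : a.toFree ⟶ b.toFree) :
    (can Y h).hom = evMap Y f :=
  congrArg (evMap Y) (Subsingleton.elim _ _)

theorem can_refl {a : Word ι} (h : a.length = a.length) : (can Y h).hom = 𝟙 (ev Y a) := by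
  rw [can_eq Y h (𝟙 _), evMap_id]

theorem can_trans {a : Word ι} {b : Word κ} {c : Word μ} (h : a.length = b.length)
    (h' : b.length = c.length) :
    (can Y h).hom ≫ (can Y h').hom = (can Y (h.trans h')).hom := by
  rw [can_eq Y _ ((freeIso h).hom ≫ (freeIso h').hom), evMap_comp]; rfl

theorem can_trans_assoc {a : Word ι} {b : Word κ} {c : Word μ} (h : a.length = b.length)
    (h' : b.length = c.length) {Z : E} (f : ev Y c ⟶ Z) :
    (can Y h).hom ≫ (can Y h').hom ≫ f = (can Y (h.trans h')).hom ≫ f := by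
  rw [← can_trans Y h h', Category.assoc]

theorem can_inv {a : Word ι} {b : Word κ} (h : a.length = b.length) :
    (can Y h).inv = (can Y h.symm).hom :=
  (can_eq Y h.symm (freeIso h).inv).symm

theorem evMap_tensor {a : Word ι} {b : Word κ} {a' : Word ι} {b' : Word κ}
    (f : a.toFree ⟶ b.toFree) (g : a'.toFree ⟶ b'.toFree) :
    evMap Y (a := a.tensor a') (b := b.tensor b') (f ⊗ₘ g) = evMap Y f ⊗ₘ evMap Y g := by
  -- Stated for arbitrary isomorphisms in `E`, since the objects in the goal are tensor products only
  -- up to unfolding of `project`.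
  have key {A B C D A' B' C' D' : E} (e₁ : A ≅ B) (p : B ⟶ C) (e₂ : D ≅ C) (e₁' : A' ≅ B')
      (p' : B' ⟶ C') (e₂' : D' ≅ C') : (e₁ ⊗ᵢ e₁').hom ≫ (p ⊗ₘ p') ≫ (e₂ ⊗ᵢ e₂').inv =
        (e₁.hom ≫ p ≫ e₂.inv) ⊗ₘ (e₁'.hom ≫ p' ≫ e₂'.inv) := by
    simp
  refine Eq.trans ?_ (key ..)
  induction f using Quotient.inductionOn
  induction g using Quotient.inductionOn
  rfl

theorem can_tensor {a : Word ι} {b : Word κ} {a' : Word ι} {b' : Word κ}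
    (h : a.length = b.length) (h' : a'.length = b'.length)
    (h'' : (a.tensor a').length = (b.tensor b').length) :
    (can Y h'').hom = (can Y h).hom ⊗ₘ (can Y h').hom := by
  rw [can_eq Y h'' ((freeIso h).hom ⊗ₘ (freeIso h').hom), evMap_tensor]
  rfl

theorem can_assoc (a b c : Word ι)
    (h : ((a.tensor b).tensor c).length = (a.tensor (b.tensor c)).length) :
    (can Y h).hom = (α_ (ev Y a) (ev Y b) (ev Y c)).hom := by
  rw [can_eq Y h (α_ a.toFree b.toFree c.toFree).hom]
  have key {A B C A' B' C' : E} (e₁ : A ≅ A') (e₂ : B ≅ B') (e₃ : C ≅ C') :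
      ((e₁ ⊗ᵢ e₂) ⊗ᵢ e₃).hom ≫ (α_ A' B' C').hom ≫ (e₁ ⊗ᵢ (e₂ ⊗ᵢ e₃)).inv =
        (α_ A B C).hom := by
    rw [← Category.assoc, Iso.comp_inv_eq]
    exact associator_naturality ..
  exact key (evIso Y a) (evIso Y b) (evIso Y c)

theorem can_leftUnitor (a : Word ι) (h : (unit.tensor a).length = a.length) :
    (can Y h).hom = (λ_ (ev Y a)).hom := by
  rw [can_eq Y h (λ_ a.toFree).hom]
  have key {A A' : E} (e : A ≅ A') :
      (Iso.refl (𝟙_ E) ⊗ᵢ e).hom ≫ (λ_ A').hom ≫ e.inv = (λ_ A).hom := by simp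
  exact key (evIso Y a)

theorem can_rightUnitor (a : Word ι) (h : (a.tensor unit).length = a.length) :
    (can Y h).hom = (ρ_ (ev Y a)).hom := by
  rw [can_eq Y h (ρ_ a.toFree).hom]
  have key {A A' : E} (e : A ≅ A') :
      (e ⊗ᵢ Iso.refl (𝟙_ E)).hom ≫ (ρ_ A').hom ≫ e.inv = (ρ_ A).hom := by simp
  exact key (evIso Y a)

/-! ### The action of the braid group on a tensor power -/

variable [BraidedCategory E]

/-- The braiding of the first two factors of `Y ⊗ (Y ⊗ Z)`. -/
def frontSwap (Z : E) : Y ⊗ (Y ⊗ Z) ≅ Y ⊗ (Y ⊗ Z) :=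
  (α_ Y Y Z).symm ≪≫ whiskerRightIso (β_ Y Y) Z ≪≫ α_ Y Y Z

theorem frontSwap_naturality {Z Z' : E} (f : Z ⟶ Z') :
    (frontSwap Y Z).hom ≫ Y ◁ Y ◁ f = Y ◁ Y ◁ f ≫ (frontSwap Y Z').hom := by
  simp only [frontSwap, Iso.trans_hom, Iso.symm_hom, whiskerRightIso_hom, Category.assoc]
  rw [← associator_naturality_right, ← whisker_exchange_assoc,
    associator_inv_naturality_right_assoc]

theorem frontSwap_braid (Z : E) :
    (frontSwap Y (Y ⊗ Z)).hom ≫ Y ◁ (frontSwap Y Z).hom ≫ (frontSwap Y (Y ⊗ Z)).hom =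
      Y ◁ (frontSwap Y Z).hom ≫ (frontSwap Y (Y ⊗ Z)).hom ≫ Y ◁ (frontSwap Y Z).hom := by
  have h := congrArg (fun f : (Y ⊗ Y) ⊗ Y ⟶ (Y ⊗ Y) ⊗ Y =>
    𝟙 (Y ⊗ (Y ⊗ (Y ⊗ Z))) ⊗≫ f ▷ Z ⊗≫ 𝟙 (Y ⊗ (Y ⊗ (Y ⊗ Z))))
      (BraidedCategory.yang_baxter' Y Y Y)
  simp only [frontSwap, Iso.trans_hom, Iso.symm_hom, whiskerRightIso_hom]
  refine Eq.trans ?_ (h.trans ?_) <;> monoidal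

/-- The braiding of the factors in positions `i` and `i + 1` of the `n`-th tensor power of `Y`. If
there are no such factors, it is an identity. -/
def swapAt : ℕ → (n : ℕ) → (ev Y (pow n) ≅ ev Y (pow n))
  | 0, 0 => Iso.refl _
  | 0, 1 => Iso.refl _
  | 0, n + 2 => frontSwap Y (ev Y (pow n))
  | _ + 1, 0 => Iso.refl _
  | i + 1, n + 1 => whiskerLeftIso Y (swapAt i n)

theorem swapAt_comm (i j n : ℕ) (h : i + 2 ≤ j) (hj : j + 1 < n) :
    (swapAt Y i n).hom ≫ (swapAt Y j n).hom = (swapAt Y j n).hom ≫ (swapAt Y i n).hom := by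
  induction i generalizing j n with
  | zero =>
    obtain ⟨j, rfl⟩ := Nat.exists_eq_add_of_le' h
    obtain ⟨n, rfl⟩ := Nat.exists_eq_add_of_le' (show 2 ≤ n by omega)
    exact frontSwap_naturality Y (swapAt Y j n).hom
  | succ i ih =>
    obtain ⟨j, rfl⟩ := Nat.exists_eq_add_of_le' (show 1 ≤ j by omega)
    obtain ⟨n, rfl⟩ := Nat.exists_eq_add_of_le' (show 1 ≤ n by omega)
    have := congrArg (Y ◁ ·) (ih j n (by omega) (by omega))
    simp only [whiskerLeft_comp] at this
    exact this

theorem swapAt_braid (i n : ℕ) (hj : i + 2 < n) :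
    (swapAt Y i n).hom ≫ (swapAt Y (i + 1) n).hom ≫ (swapAt Y i n).hom =
      (swapAt Y (i + 1) n).hom ≫ (swapAt Y i n).hom ≫ (swapAt Y (i + 1) n).hom := by
  induction i generalizing n with
  | zero =>
    obtain ⟨n, rfl⟩ := Nat.exists_eq_add_of_le' (show 3 ≤ n by omega)
    exact frontSwap_braid Y (ev Y (pow n))
  | succ i ih =>
    obtain ⟨n, rfl⟩ := Nat.exists_eq_add_of_le' (show 1 ≤ n by omega)
    have := congrArg (Y ◁ ·) (ih n (by omega))
    simp only [whiskerLeft_comp] at this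
    exact this

end Word

namespace BraidGroup

theorem induction {n : ℕ} {p : BraidGroup n → Prop} (one : p 1) (gen : ∀ i, p (σ i))
    (mul : ∀ x y, p x → p y → p (x * y)) (inv : ∀ x, p x → p x⁻¹) (x : BraidGroup n) : p x := by
  have hx : x ∈ Subgroup.closure (Set.range (PresentedGroup.of (rels := artinRels n))) := by
    rw [PresentedGroup.closure_range_of]; trivial
  induction hx using Subgroup.closure_induction with
  | mem x hx => obtain ⟨i, rfl⟩ := hx; exact gen i
  | one => exact one
  | mul x y _ _ hx hy => exact mul x y hx hy
  | inv x _ hx => exact inv x hx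

theorem place_σ {k m n : ℕ} (h : k + m ≤ n) (i : Fin (m - 1)) :
    place k m n h (σ i) = σ ⟨k + i, by have := i.isLt; omega⟩ :=
  PresentedGroup.toGroup.of _

end BraidGroup

namespace Word

variable {ι κ : Type*} {E : Type u} [Category.{v} E] [MonoidalCategory E] (Y : E)

theorem length_pow_tensor {m k n : ℕ} (h : m + k = n) :
    ((pow m).tensor (pow k)).length = (pow n).length := by
  rw [length_tensor, length_pow, length_pow, length_pow, h]

theorem can_whiskerLeft (c : Word ι) {a b : Word ι} (h : a.length = b.length)
    (h' : (c.tensor a).length = (c.tensor b).length) : (can Y h').hom = ev Y c ◁ (can Y h).hom := by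
  rw [can_tensor Y rfl h, can_refl]
  exact id_tensorHom _ _

theorem can_pow_succ {m n : ℕ} {b : Word PUnit.{1}}
    (h : ((pow m).tensor b).length = (pow n).length)
    (h' : ((pow (m + 1)).tensor b).length = (pow (n + 1)).length) :
    (can Y h').hom = (α_ Y (ev Y (pow m)) (ev Y b)).hom ≫ Y ◁ (can Y h).hom := by
  have h₁ : ((pow (m + 1)).tensor b).length =
      (tensor (.var ⟨⟩) ((pow m).tensor b)).length := Nat.add_assoc _ _ _
  have h₂ : (tensor (.var ⟨⟩ : Word PUnit.{1}) ((pow m).tensor b)).length =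
      (pow (n + 1)).length := congrArg (1 + ·) h
  refine (can_trans Y h₁ h₂).symm.trans ?_
  rw [can_assoc, can_whiskerLeft Y _ h]

variable [BraidedCategory E]

theorem frontSwap_whiskerRight (Z W : E) :
    (frontSwap Y Z).hom ▷ W ≫ (α_ Y (Y ⊗ Z) W).hom ≫ Y ◁ (α_ Y Z W).hom =
      (α_ Y (Y ⊗ Z) W).hom ≫ Y ◁ (α_ Y Z W).hom ≫ (frontSwap Y (Z ⊗ W)).hom := by
  simp only [frontSwap, Iso.trans_hom, Iso.symm_hom, whiskerRightIso_hom]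
  monoidal

theorem swapAt_whiskerRight {i m k n : ℕ} (h : ((pow m).tensor (pow k)).length = (pow n).length)
    (hi : i + 1 < m) :
    (swapAt Y i m).hom ▷ ev Y (pow k) ≫ (can Y h).hom = (can Y h).hom ≫ (swapAt Y i n).hom := by
  have hn : m + k = n := by simpa using h
  induction i generalizing m n with
  | zero =>
    obtain ⟨m, rfl⟩ := Nat.exists_eq_add_of_le' (show 2 ≤ m by omega)
    obtain ⟨n, rfl⟩ := Nat.exists_eq_add_of_le' (show 2 ≤ n by omega)
    have h₁ : ((pow (m + 1)).tensor (pow k)).length = (pow (n + 1)).length :=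
      length_pow_tensor (by omega)
    have h₂ : ((pow m).tensor (pow k)).length = (pow n).length := length_pow_tensor (by omega)
    rw [can_pow_succ Y h₁, can_pow_succ Y h₂]
    change (frontSwap Y (ev Y (pow m))).hom ▷ _ ≫ _ = _ ≫ (frontSwap Y (ev Y (pow n))).hom
    simp only [whiskerLeft_comp, Category.assoc]
    rw [← frontSwap_naturality]
    exact (reassoc_of% frontSwap_whiskerRight Y (ev Y (pow m)) (ev Y (pow k))) _
  | succ i ih =>
    obtain ⟨m, rfl⟩ := Nat.exists_eq_add_of_le' (show 1 ≤ m by omega)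
    obtain ⟨n, rfl⟩ := Nat.exists_eq_add_of_le' (show 1 ≤ n by omega)
    have h₁ : ((pow m).tensor (pow k)).length = (pow n).length := length_pow_tensor (by omega)
    rw [can_pow_succ Y h₁]
    change (Y ◁ (swapAt Y i m).hom) ▷ _ ≫ _ = _ ≫ Y ◁ (swapAt Y i n).hom
    have := congrArg (Y ◁ ·) (ih h₁ (by omega) (by omega))
    simp only [whiskerLeft_comp] at this
    rw [Category.assoc, ← this]
    exact associator_naturality_middle_assoc ..

theorem swapAt_whiskerLeft {i m k n : ℕ} (h : ((pow m).tensor (pow k)).length = (pow n).length) :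
    ev Y (pow m) ◁ (swapAt Y i k).hom ≫ (can Y h).hom =
      (can Y h).hom ≫ (swapAt Y (m + i) n).hom := by
  have hn : m + k = n := by simpa using h
  induction m generalizing n with
  | zero =>
    obtain rfl : k = n := by omega
    rw [Nat.zero_add]
    rw [can_leftUnitor Y]
    exact leftUnitor_naturality ..
  | succ m ih =>
    obtain ⟨n, rfl⟩ := Nat.exists_eq_add_of_le' (show 1 ≤ n by omega)
    have h₁ : ((pow m).tensor (pow k)).length = (pow n).length := length_pow_tensor (by omega)
    rw [can_pow_succ Y h₁, Nat.add_right_comm m 1 i]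
    change _ = _ ≫ Y ◁ (swapAt Y (m + i) n).hom
    have := congrArg (Y ◁ ·) (ih h₁ (by omega))
    simp only [whiskerLeft_comp] at this
    rw [Category.assoc, ← this]
    exact associator_naturality_right_assoc ..

/-- The action of the braid group on the tensor power of `Y`. The group of automorphisms has the
opposite multiplication since `a * b` means first `a`, then `b` in the braid group, whereas `f * g`
means first `g`, then `f` in `Aut`. -/
def actHom (n : ℕ) : BraidGroup n →* (Aut (ev Y (pow n)))ᵐᵒᵖ :=
  PresentedGroup.toGroup
    (f := fun i : Fin (n - 1) => (MulOpposite.op (swapAt Y i n) : (Aut (ev Y (pow n)))ᵐᵒᵖ)) (by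
      rintro r (⟨i, j, hij, rfl⟩ | ⟨i, j, hij, rfl⟩)
      · simp only [map_mul, map_inv, FreeGroup.lift_apply_of]
        exact mul_inv_eq_one.mpr (MulOpposite.unop_injective
          (Iso.ext (swapAt_comm Y i j n hij (by have := j.isLt; omega))))
      · simp only [map_mul, map_inv, FreeGroup.lift_apply_of]
        refine mul_inv_eq_one.mpr (MulOpposite.unop_injective (Iso.ext ?_))
        have := swapAt_braid Y i n (by have := j.isLt; omega)
        rw [hij] at this
        exact (Category.assoc ..).trans (this.trans (Category.assoc ..).symm))

/-- The automorphism of the tensor power of `Y` by which a braid acts. -/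
def act {n : ℕ} (x : BraidGroup n) : ev Y (pow n) ≅ ev Y (pow n) := (actHom Y n x).unop

theorem act_one (n : ℕ) : act Y (1 : BraidGroup n) = Iso.refl _ := by
  rw [act, map_one]; rfl

theorem act_mul {n : ℕ} (x y : BraidGroup n) : act Y (x * y) = act Y x ≪≫ act Y y := by
  rw [act, map_mul]; rfl

theorem act_inv {n : ℕ} (x : BraidGroup n) : act Y x⁻¹ = (act Y x).symm := by
  rw [act, map_inv]; rfl

theorem act_σ {n : ℕ} (i : Fin (n - 1)) : act Y (BraidGroup.σ i) = swapAt Y i n :=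
  congrArg (fun x : (Aut (ev Y (pow n)))ᵐᵒᵖ => x.unop) (PresentedGroup.toGroup.of _)

/-- A braid placed on the first `m` positions acts on the first tensor factor. -/
theorem act_place_zero {m k n : ℕ} (h : ((pow m).tensor (pow k)).length = (pow n).length)
    (hn : 0 + m ≤ n) (x : BraidGroup m) :
    (act Y x).hom ▷ ev Y (pow k) ≫ (can Y h).hom =
      (can Y h).hom ≫ (act Y (BraidGroup.place 0 m n hn x)).hom := by
  induction x using BraidGroup.induction with
  | one => simp [act_one]
  | gen i =>
    rw [BraidGroup.place_σ, act_σ, act_σ]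
    convert! swapAt_whiskerRight Y h _ using 4
    · exact Nat.zero_add _
    · have := i.isLt; omega
  | mul x y hx hy =>
    rw [map_mul, act_mul, act_mul, Iso.trans_hom, Iso.trans_hom, comp_whiskerRight,
      Category.assoc, hy, ← Category.assoc, hx, Category.assoc]
  | inv x hx =>
    rw [map_inv, act_inv, act_inv, Iso.symm_hom, Iso.symm_hom, Iso.eq_comp_inv, Category.assoc,
      ← hx, inv_hom_whiskerRight_assoc]

/-- A braid placed on the last `k` positions acts on the second tensor factor. -/
theorem act_place_left {m k n : ℕ} (h : ((pow m).tensor (pow k)).length = (pow n).length)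
    (hn : m + k ≤ n) (x : BraidGroup k) :
    ev Y (pow m) ◁ (act Y x).hom ≫ (can Y h).hom =
      (can Y h).hom ≫ (act Y (BraidGroup.place m k n hn x)).hom := by
  induction x using BraidGroup.induction with
  | one => simp [act_one]
  | gen i =>
    rw [BraidGroup.place_σ, act_σ, act_σ]
    exact swapAt_whiskerLeft Y h
  | mul x y hx hy =>
    rw [map_mul, act_mul, act_mul, Iso.trans_hom, Iso.trans_hom, whiskerLeft_comp,
      Category.assoc, hy, ← Category.assoc, hx, Category.assoc]
  | inv x hx =>
    rw [map_inv, act_inv, act_inv, Iso.symm_hom, Iso.symm_hom, Iso.eq_comp_inv, Category.assoc,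
      ← hx, whiskerLeft_inv_hom_assoc]

/-- The morphism `f` between the values at `Y` of two words of length `n` is the action of the braid
`x`, up to the canonical isomorphisms from these words to the tensor power `pow n`. -/
def Represents {n : ℕ} (x : BraidGroup n) {a b : Word ι} (f : ev Y a ⟶ ev Y b) : Prop :=
  ∃ (ha : a.length = (pow n).length) (hb : (pow n).length = b.length),
    f = (can Y ha).hom ≫ (act Y x).hom ≫ (can Y hb).hom

namespace Represents
variable {Y}

theorem can_hom {n : ℕ} {a b : Word ι} (hn : a.length = n) (h : a.length = b.length) :
    Represents Y (1 : BraidGroup n) (can Y h).hom := by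
  refine ⟨by simpa using hn, by simpa [← h] using hn.symm, ?_⟩
  rw [act_one, Iso.refl_hom, Category.id_comp, can_trans]

theorem comp {n : ℕ} {x y : BraidGroup n} {a b c : Word ι} {f : ev Y a ⟶ ev Y b}
    {g : ev Y b ⟶ ev Y c} (hf : Represents Y x f) (hg : Represents Y y g) :
    Represents Y (x * y) (f ≫ g) := by
  obtain ⟨ha, hb, rfl⟩ := hf
  obtain ⟨_, hc, rfl⟩ := hg
  refine ⟨ha, hc, ?_⟩
  simp [act_mul, can_trans_assoc, can_refl]

theorem inv {n : ℕ} {x : BraidGroup n} {a b : Word ι} {f : ev Y a ≅ ev Y b}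
    (hf : Represents Y x f.hom) : Represents Y x⁻¹ f.inv := by
  obtain ⟨ha, hb, hf⟩ := hf
  refine ⟨hb.symm, ha.symm, ?_⟩
  obtain rfl : f = can Y ha ≪≫ act Y x ≪≫ can Y hb := Iso.ext hf
  simp [act_inv, can_inv]

theorem whiskerRight {m n : ℕ} {x : BraidGroup m} {a b : Word ι} {f : ev Y a ⟶ ev Y b}
    (hf : Represents Y x f) (c : Word ι) (hn : m + c.length = n) (h : 0 + m ≤ n) :
    Represents Y (BraidGroup.place 0 m n h x) (a := a.tensor c) (b := b.tensor c) (f ▷ ev Y c) := by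
  obtain ⟨ha, hb, rfl⟩ := hf
  have ha' : (a.tensor c).length = (pow n).length := by simp_all
  have hb' : (pow n).length = (b.tensor c).length := by simp_all
  refine ⟨ha', hb', ?_⟩
  have h₁ : ((pow m).tensor (pow c.length)).length = (pow n).length := by simp_all
  have hc : c.length = (pow c.length).length := (length_pow _).symm
  have h₂ : (a.tensor c).length = ((pow m).tensor (pow c.length)).length := ha'.trans h₁.symm
  have h₃ : ((pow m).tensor (pow c.length)).length = (b.tensor c).length := h₁.trans hb'
  rw [← can_trans Y h₂ h₁, ← can_trans Y h₁.symm h₃, Category.assoc,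
    ← reassoc_of% act_place_zero Y h₁ h x, can_trans_assoc, can_refl, Category.id_comp,
    can_tensor Y ha hc, can_tensor Y hb hc.symm]
  have := can_trans Y hc hc.symm
  simp only [can_refl] at this
  simp [tensorHom_def', ← whisker_exchange_assoc, ← whiskerLeft_comp_assoc, this]

theorem whiskerLeft {m k n : ℕ} {x : BraidGroup k} {a b : Word ι} {f : ev Y a ⟶ ev Y b}
    (hf : Represents Y x f) (c : Word ι) (hm : c.length = m) (hn : m + k = n) (h : m + k ≤ n) :
    Represents Y (BraidGroup.place m k n h x) (a := c.tensor a) (b := c.tensor b) (ev Y c ◁ f) := by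
  obtain ⟨ha, hb, rfl⟩ := hf
  have ha' : (c.tensor a).length = (pow n).length := by simp_all
  have hb' : (pow n).length = (c.tensor b).length := by simp_all
  refine ⟨ha', hb', ?_⟩
  have h₁ : ((pow m).tensor (pow k)).length = (pow n).length := by simp_all
  have hc : c.length = (pow m).length := hm.trans (length_pow _).symm
  have h₂ : (c.tensor a).length = ((pow m).tensor (pow k)).length := ha'.trans h₁.symm
  have h₃ : ((pow m).tensor (pow k)).length = (c.tensor b).length := h₁.trans hb'
  rw [← can_trans Y h₂ h₁, ← can_trans Y h₁.symm h₃, Category.assoc,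
    ← reassoc_of% act_place_left Y h₁ h x, can_trans_assoc, can_refl, Category.id_comp,
    can_tensor Y hc ha, can_tensor Y hc.symm hb]
  have := can_trans Y hc hc.symm
  simp only [can_refl] at this
  simp [MonoidalCategory.tensorHom_def, whisker_exchange_assoc, ← comp_whiskerRight_assoc, this]

end Represents

end Word

/-! ### Formal structural isomorphisms act by their underlying braids -/

namespace BraidGroup

theorem cross_zero_left (q n : ℕ) (h : 0 + q = n) : cross 0 q n h = 1 := by
  simp [cross]

theorem cross_one_zero (n : ℕ) (h : 1 + 0 = n) : cross 1 0 n h = 1 := by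
  simp [cross]

theorem cross_one_left (q n : ℕ) (h : 1 + q = n) :
    cross 1 q n h = (List.ofFn fun j : Fin q => (σ ⟨j, by omega⟩ : BraidGroup n)).prod := by
  simp [cross, List.ofFn_succ]

/-- One strand crosses `q + 1` strands by crossing the first of them and then the others. -/
theorem cross_one_succ (q n : ℕ) (h : 1 + (q + 1) = n) :
    cross 1 (q + 1) n h =
      place 0 2 n (by omega) (σ ⟨0, by omega⟩) *
        place 1 (1 + q) n (by omega) (cross 1 q (1 + q) rfl) := by
  simp only [cross_one_left, List.ofFn_succ (n := q), List.prod_cons, map_list_prod,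
    List.map_ofFn, place_σ, Function.comp_def]
  congr! 5
  simp [Nat.add_comm]

/-- A block of `p + 1` strands crosses a block by letting its last strand cross first. -/
theorem cross_succ_left (p q n : ℕ) (h : p + 1 + q = n) :
    cross (p + 1) q n h =
      place p (1 + q) n (by omega) (cross 1 q (1 + q) rfl) *
        place 0 (p + q) n (by omega) (cross p q (p + q) rfl) := by
  rw [cross_one_left]
  simp only [cross, List.ofFn_succ (n := p), List.prod_cons,
    map_list_prod, List.map_ofFn, place_σ, Function.comp_def]
  congr! 5
  simp only [Fin.val_succ, Nat.add_sub_cancel, Nat.zero_add, Nat.sub_sub, Nat.add_comm 1]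

end BraidGroup

namespace Word
variable {ι κ : Type*} {E : Type u} [Category.{v} E] [MonoidalCategory E] [BraidedCategory E]
  {Y : E}

namespace Represents

theorem congr {n : ℕ} {x y : BraidGroup n} {a b : Word ι} {f g : ev Y a ⟶ ev Y b}
    (hf : Represents Y x f) (h : f = g) (h' : x = y) : Represents Y y g := h ▸ h' ▸ hf

/-- By naturality of the braiding, the braid that represents `β` depends only on the lengths of the
two words. -/
theorem braiding_congr {n : ℕ} {x : BraidGroup n} {a b : Word ι} {a' b' : Word κ}
    (hx : Represents Y x (a := a.tensor b) (b := b.tensor a) (β_ (ev Y a) (ev Y b)).hom)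
    (ha : a'.length = a.length) (hb : b'.length = b.length) :
    Represents Y x (a := a'.tensor b') (b := b'.tensor a') (β_ (ev Y a') (ev Y b')).hom := by
  obtain ⟨h₁, h₂, h⟩ := hx
  have h₃ : (a'.tensor b').length = (a.tensor b).length := congrArg₂ _ ha hb
  have h₄ : (b.tensor a).length = (b'.tensor a').length := congrArg₂ _ hb.symm ha.symm
  have key : (β_ (ev Y a') (ev Y b')).hom =
      (can Y h₃).hom ≫ (β_ (ev Y a) (ev Y b)).hom ≫ (can Y h₄).hom := by
    rw [can_tensor Y ha hb, can_tensor Y hb.symm ha.symm, ← can_inv Y ha, ← can_inv Y hb,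
      BraidedCategory.braiding_naturality_assoc]
    simp
  refine ⟨h₃.trans h₁, h₂.trans h₄, ?_⟩
  rw [key, h]
  simp only [Category.assoc, can_trans, can_trans_assoc]

theorem braiding_var {n : ℕ} (h : 2 = n) (i j : ι) :
    Represents Y (BraidGroup.σ (n := n) ⟨0, by omega⟩) (a := (var i).tensor (var j))
      (b := (var j).tensor (var i)) (β_ Y Y).hom := by
  subst h
  have h₁ (i j : ι) : ((var i).tensor (var j)).length = (pow 2).length := rfl
  refine ⟨h₁ i j, (h₁ j i).symm, ?_⟩
  have h₂ (i : ι) : (var i).length = (var ⟨⟩ : Word PUnit.{1}).length := rfl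
  have h₃ : (var ⟨⟩ : Word PUnit.{1}).length =
    ((var ⟨⟩ : Word PUnit.{1}).tensor unit).length := rfl
  have h₄ (i : ι) : (can Y (h₂ i)).hom = 𝟙 Y :=
    (can_eq Y (h₂ i) (𝟙 (var i).toFree :)).trans (evMap_id Y (var i))
  have h₅ (i j : ι) : (can Y (h₁ i j)).hom = Y ◁ (ρ_ Y).inv := by
    rw [can_tensor Y (h₂ i) ((h₂ j).trans h₃), ← can_trans Y (h₂ j) h₃, h₄, h₄,
      ← can_inv Y h₃.symm, Category.id_comp, id_tensorHom]
    congr 1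
    exact congrArg Iso.inv (Iso.ext (can_rightUnitor Y (var ⟨⟩) h₃.symm))
  rw [← can_inv Y (h₁ j i), ← Category.assoc, Iso.eq_comp_inv, h₅, h₅, act_σ]
  change _ = _ ≫ (frontSwap Y (𝟙_ E)).hom
  simp only [frontSwap, Iso.trans_hom, Iso.symm_hom, whiskerRightIso_hom]
  monoidal

theorem assoc {n : ℕ} {a b c : Word ι} (h : ((a.tensor b).tensor c).length = n) :
    Represents Y (1 : BraidGroup n) (a := (a.tensor b).tensor c) (b := a.tensor (b.tensor c))
      (α_ (ev Y a) (ev Y b) (ev Y c)).hom := by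
  have h' : ((a.tensor b).tensor c).length = (a.tensor (b.tensor c)).length := Nat.add_assoc ..
  exact (can_hom h h').congr (can_assoc Y a b c h') rfl

theorem assoc_inv {n : ℕ} {a b c : Word ι} (h : ((a.tensor b).tensor c).length = n) :
    Represents Y (1 : BraidGroup n) (b := (a.tensor b).tensor c) (a := a.tensor (b.tensor c))
      (α_ (ev Y a) (ev Y b) (ev Y c)).inv :=
  (assoc h).inv.congr rfl inv_one

theorem leftUnitor {n : ℕ} {a : Word ι} (h : a.length = n) :
    Represents Y (1 : BraidGroup n) (a := unit.tensor a) (b := a) (λ_ (ev Y a)).hom := by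
  have h' : (unit.tensor a).length = a.length := Nat.zero_add _
  exact (can_hom (h'.trans h) h').congr (can_leftUnitor Y a h') rfl

theorem rightUnitor {n : ℕ} {a : Word ι} (h : a.length = n) :
    Represents Y (1 : BraidGroup n) (a := a.tensor unit) (b := a) (ρ_ (ev Y a)).hom := by
  have h' : (a.tensor unit).length = a.length := rfl
  exact (can_hom (h'.trans h) h').congr (can_rightUnitor Y a h') rfl

/-- The braiding of `Y` with a tensor power is the crossing of one strand with a block, by the
hexagon that splits off a factor on the right. -/
theorem braiding_var_pow (q : ℕ) {n : ℕ} (h : 1 + q = n) :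
    Represents Y (BraidGroup.cross 1 q n h) (a := tensor (var ⟨⟩) (pow q))
      (b := tensor (pow q) (var ⟨⟩)) (β_ Y (ev Y (pow q))).hom := by
  induction q generalizing n with
  | zero =>
    have h' : (var ⟨⟩ : Word PUnit.{1}).length = n := h
    refine ((rightUnitor h').comp (leftUnitor h').inv).congr ?_ ?_
    · exact (braiding_tensorUnit_right Y).symm
    · rw [BraidGroup.cross_one_zero, inv_one, mul_one]
  | succ q ih =>
    have h₁ : (((var ⟨⟩ : Word PUnit.{1}).tensor (var ⟨⟩)).tensor (pow q)).length = n := by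
      rw [length_tensor, length_tensor, length_pow]
      simp only [length]; omega
    have h₂ : (((var ⟨⟩ : Word PUnit.{1}).tensor (pow q)).tensor (var ⟨⟩)).length = n := by
      rw [length_tensor, length_tensor, length_pow]
      simp only [length]; omega
    refine ((assoc_inv h₁).comp (((braiding_var rfl _ _).whiskerRight (pow q) ?_ ?_).comp
      ((assoc h₁).comp (((ih rfl).whiskerLeft (var ⟨⟩) rfl ?_ ?_).comp (assoc_inv h₂))))).congr
      (BraidedCategory.braiding_tensor_right_hom Y Y (ev Y (pow q))).symm ?_
    · rw [length_pow]; omega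
    · omega
    · simp only [length]; omega
    · change 1 + (1 + q) ≤ n; omega
    · rw [BraidGroup.cross_one_succ, one_mul, one_mul, mul_one]; rfl

/-- The braiding of two tensor powers is the crossing of two blocks, by the hexagon that splits off
a factor on the left. -/
theorem braiding_pow_pow (p q : ℕ) {n : ℕ} (h : p + q = n) :
    Represents Y (BraidGroup.cross p q n h) (a := tensor (pow p) (pow q))
      (b := tensor (pow q) (pow p)) (β_ (ev Y (pow p)) (ev Y (pow q))).hom := by
  induction p generalizing n with
  | zero =>
    have h' : (pow q).length = n := by rw [length_pow, ← h, Nat.zero_add]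
    refine ((leftUnitor h').comp (rightUnitor h').inv).congr ?_ ?_
    · exact (braiding_tensorUnit_left _).symm
    · rw [BraidGroup.cross_zero_left, inv_one, mul_one]
  | succ p ih =>
    -- The strand that crosses first is the last one of the left block, so the block is rebracketed
    -- as `pow p ⊗ Y`.
    have h₀ : (pow (p + 1)).length = ((pow p).tensor (var ⟨⟩ : Word PUnit.{1})).length :=
      Nat.add_comm _ _
    have h₁ : (((pow p).tensor (var ⟨⟩)).tensor (pow q)).length = n := by
      rw [length_tensor, length_tensor, length_pow, length_pow]
      simp only [length]; omega
    have h₂ : (((pow p).tensor (pow q)).tensor (var ⟨⟩)).length = n := by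
      rw [length_tensor, length_tensor, length_pow, length_pow]
      simp only [length]; omega
    have h₃ : (((pow q).tensor (pow p)).tensor (var ⟨⟩)).length = n := by
      rw [length_tensor, length_tensor, length_pow, length_pow]
      simp only [length]; omega
    have key := ((assoc h₁).comp (((braiding_var_pow (Y := Y) q rfl).whiskerLeft (pow p)
      (length_pow p) (n := n) (by omega) (by omega)).comp ((assoc_inv h₂).comp
      (((ih rfl).whiskerRight (var ⟨⟩) (n := n) (by simp only [length]; omega) (by omega)).comp
        (assoc h₃))))).congr
      (BraidedCategory.braiding_tensor_left_hom (ev Y (pow p)) Y (ev Y (pow q))).symm rfl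
    refine (key.braiding_congr h₀ rfl).congr rfl ?_
    rw [BraidGroup.cross_succ_left p, one_mul, one_mul, mul_one]

theorem braiding {a b : Word ι} {n : ℕ} (h : a.length + b.length = n) :
    Represents Y (BraidGroup.cross a.length b.length n h) (a := a.tensor b)
      (b := b.tensor a) (β_ (ev Y a) (ev Y b)).hom :=
  (braiding_pow_pow a.length b.length h).braiding_congr (length_pow _).symm (length_pow _).symm

theorem tensor {s t s' t' : Word ι} {x : BraidGroup s.length} {y : BraidGroup s'.length}
    {f : ev Y s ⟶ ev Y t} {g : ev Y s' ⟶ ev Y t'} (hf : Represents Y x f)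
    (hg : Represents Y y g) {n : ℕ} (h : s.length + s'.length = n) (h₁ : 0 + s.length ≤ n)
    (h₂ : s.length + s'.length ≤ n) :
    Represents Y (BraidGroup.place 0 _ n h₁ x * BraidGroup.place _ _ n h₂ y)
      (a := s.tensor s') (b := t.tensor t') (f ⊗ₘ g) := by
  have ht : t.length = s.length := by
    obtain ⟨ha, hb, -⟩ := hf
    exact (ha.trans hb).symm
  exact ((hf.whiskerRight s' h h₁).comp (hg.whiskerLeft t ht h h₂)).congr
    (MonoidalCategory.tensorHom_def f g).symm rfl

end Represents
end Word

namespace Struct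
variable {ι : Type*} {E : Type u} [Category.{v} E] [MonoidalCategory E] [BraidedCategory E] (Y : E)

/-- The value of a formal structural isomorphism at a single object `Y`, substituted for all
variables. -/
def ev : {s t : Word ι} → Struct s t → (s.ev Y ≅ t.ev Y)
  | _, _, .id s => Iso.refl (s.ev Y)
  | _, _, .comp f g => f.ev ≪≫ g.ev
  | _, _, .inv f => f.ev.symm
  | _, _, .tensor f g => f.ev ⊗ᵢ g.ev
  | _, _, .assoc s t u => α_ (s.ev Y) (t.ev Y) (u.ev Y)
  | _, _, .leftUnitor s => λ_ (s.ev Y)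
  | _, _, .rightUnitor s => ρ_ (s.ev Y)
  | _, _, .braiding s t => β_ (s.ev Y) (t.ev Y)

/-- A formal structural isomorphism acts on the values at one object as its underlying braid does. -/
theorem represents_braidAt {s t : Word ι} (f : Struct s t) (n : ℕ) (h : s.length = n) :
    Word.Represents Y (f.braidAt n h) (f.ev Y).hom := by
  induction f generalizing n with
  | id s => exact (Word.Represents.can_hom h rfl).congr (Word.can_refl Y rfl) rfl
  | comp f g hf hg => exact (hf n h).comp (hg n _)
  | inv f hf => exact (hf n _).inv
  | tensor f g hf hg => exact (hf _ rfl).tensor (hg _ rfl) h _ _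
  | assoc s t u => exact .assoc h
  | leftUnitor s => exact .leftUnitor ((Nat.zero_add _).symm.trans h)
  | rightUnitor s => exact .rightUnitor h
  | braiding s t => exact .braiding h

end Struct

open Limits (FormalCoproduct)

/-! ### The braided monoidal category of formal coproducts -/

namespace FormalCoproduct

variable {D : Type u} [Category.{v} D]

/-- Two morphisms with definitionally equal index functions are equal if their components are. -/
theorem hom_mk_congr {X Y : FormalCoproduct.{w} D} {f : X.I → Y.I}
    {φ ψ : ∀ i, X.obj i ⟶ Y.obj (f i)} (h : ∀ i, φ i = ψ i) :
    (⟨f, φ⟩ : X.Hom Y) = ⟨f, ψ⟩ :=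
  congrArg _ (funext h)

variable [MonoidalCategory D]

/-- The tensor product of formal coproducts distributes over the coproducts. -/
instance : MonoidalCategoryStruct (FormalCoproduct.{w} D) where
  tensorObj X Y := ⟨X.I × Y.I, fun p => X.obj p.1 ⊗ Y.obj p.2⟩
  tensorUnit := ⟨PUnit, fun _ => 𝟙_ D⟩
  tensorHom f g := ⟨fun p => (f.f p.1, g.f p.2), fun p => f.φ p.1 ⊗ₘ g.φ p.2⟩
  whiskerLeft X _ _ g := ⟨fun p => (p.1, g.f p.2), fun p => X.obj p.1 ◁ g.φ p.2⟩
  whiskerRight f Y := ⟨fun p => (f.f p.1, p.2), fun p => f.φ p.1 ▷ Y.obj p.2⟩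
  associator _ _ _ :=
    { hom := ⟨fun p => (p.1.1, (p.1.2, p.2)), fun _ => (α_ _ _ _).hom⟩
      inv := ⟨fun p => ((p.1, p.2.1), p.2.2), fun _ => (α_ _ _ _).inv⟩
      hom_inv_id := hom_mk_congr fun _ => Iso.hom_inv_id _
      inv_hom_id := hom_mk_congr fun _ => Iso.inv_hom_id _ }
  leftUnitor _ :=
    { hom := ⟨fun p => p.2, fun _ => (λ_ _).hom⟩
      inv := ⟨fun p => (⟨⟩, p), fun _ => (λ_ _).inv⟩
      hom_inv_id := hom_mk_congr fun _ => Iso.hom_inv_id _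
      inv_hom_id := hom_mk_congr fun _ => Iso.inv_hom_id _ }
  rightUnitor _ :=
    { hom := ⟨fun p => p.1, fun _ => (ρ_ _).hom⟩
      inv := ⟨fun p => (p, ⟨⟩), fun _ => (ρ_ _).inv⟩
      hom_inv_id := hom_mk_congr fun _ => Iso.hom_inv_id _
      inv_hom_id := hom_mk_congr fun _ => Iso.inv_hom_id _ }

instance : MonoidalCategory (FormalCoproduct.{w} D) where
  tensorHom_def _ _ := hom_mk_congr fun _ => MonoidalCategory.tensorHom_def _ _
  id_tensorHom_id _ _ := hom_mk_congr fun _ => id_tensorHom_id _ _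
  tensorHom_comp_tensorHom _ _ _ _ := hom_mk_congr fun _ => tensorHom_comp_tensorHom _ _ _ _
  whiskerLeft_id _ _ := hom_mk_congr fun _ => whiskerLeft_id _ _
  id_whiskerRight _ _ := hom_mk_congr fun _ => id_whiskerRight _ _
  associator_naturality _ _ _ := hom_mk_congr fun _ => associator_naturality _ _ _
  leftUnitor_naturality _ := hom_mk_congr fun _ => leftUnitor_naturality _
  rightUnitor_naturality _ := hom_mk_congr fun _ => rightUnitor_naturality _
  pentagon _ _ _ _ := hom_mk_congr fun _ => pentagon _ _ _ _
  triangle _ _ := hom_mk_congr fun _ => triangle _ _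

instance [BraidedCategory D] : BraidedCategory (FormalCoproduct.{w} D) where
  braiding _ _ :=
    { hom := ⟨fun p => (p.2, p.1), fun _ => (β_ _ _).hom⟩
      inv := ⟨fun p => (p.2, p.1), fun _ => (β_ _ _).inv⟩
      hom_inv_id := hom_mk_congr fun _ => Iso.hom_inv_id _
      inv_hom_id := hom_mk_congr fun _ => Iso.inv_hom_id _ }
  braiding_naturality_right _ _ _ _ :=
    hom_mk_congr fun _ => BraidedCategory.braiding_naturality_right _ _
  braiding_naturality_left _ _ := hom_mk_congr fun _ => BraidedCategory.braiding_naturality_left _ _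
  hexagon_forward _ _ _ := hom_mk_congr fun _ => BraidedCategory.hexagon_forward _ _ _
  hexagon_reverse _ _ _ := hom_mk_congr fun _ => BraidedCategory.hexagon_reverse _ _ _

instance [SymmetricCategory D] : SymmetricCategory (FormalCoproduct.{w} D) where
  symmetry _ _ := hom_mk_congr fun _ => SymmetricCategory.symmetry _ _

/-- The pairing `A ⊗ B ⟶ X ⊗ Y` of morphisms out of objects `A` and `B` of `D`. -/
def pair {A B : D} {X Y : FormalCoproduct.{w} D} (a : (FormalCoproduct.incl D).obj A ⟶ X)
    (b : (FormalCoproduct.incl D).obj B ⟶ Y) :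
    (FormalCoproduct.incl D).obj (A ⊗ B) ⟶ X ⊗ Y :=
  ⟨fun i => (a.f i, b.f i), fun i => a.φ i ⊗ₘ b.φ i⟩

theorem pair_comp {A B : D} {X Y X' Y' : FormalCoproduct.{w} D}
    (a : (FormalCoproduct.incl D).obj A ⟶ X) (b : (FormalCoproduct.incl D).obj B ⟶ Y)
    (g : X ⟶ X') (h : Y ⟶ Y') : pair a b ≫ (g ⊗ₘ h) = pair (a ≫ g) (b ≫ h) :=
  hom_mk_congr fun _ => tensorHom_comp_tensorHom _ _ _ _

theorem map_comp_pair {A B A' B' : D} {X Y : FormalCoproduct.{w} D}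
    (a : (FormalCoproduct.incl D).obj A ⟶ X) (b : (FormalCoproduct.incl D).obj B ⟶ Y)
    (g : A' ⟶ A) (h : B' ⟶ B) : (FormalCoproduct.incl D).map (g ⊗ₘ h) ≫ pair a b =
      pair ((FormalCoproduct.incl D).map g ≫ a) ((FormalCoproduct.incl D).map h ≫ b) :=
  hom_mk_congr fun _ => tensorHom_comp_tensorHom _ _ _ _

omit [MonoidalCategory D] in
theorem map_comp_cancel {A B : D} {X : FormalCoproduct.{w} D} {g h : A ⟶ B}
    (b : (FormalCoproduct.incl D).obj B ⟶ X) [Mono (b.φ ⟨⟩)]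
    (e : (FormalCoproduct.incl D).map g ≫ b = (FormalCoproduct.incl D).map h ≫ b) : g = h := by
  obtain ⟨_, e⟩ := (FormalCoproduct.hom_ext_iff' _ _).mp e ⟨⟩
  exact (cancel_mono (b.φ ⟨⟩)).mp ((Category.comp_id _).symm.trans e)

end FormalCoproduct

/-! ### Reduction from several variables to one object -/

section

variable {ι : Type w} (C : Type u) [Category.{v} C] [MonoidalCategory C]

/-- The formal coproduct of all the variables, seen as projection functors. -/
def generic (ι : Type w) : FormalCoproduct.{w} ((ι → C) ⥤ C) :=
  ⟨ι, Pi.eval fun _ => C⟩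

/-- The inclusion of the functor of a word as one of the summands of the value of that word at the
formal coproduct of all the variables. -/
def summand : (s : Word ι) →
    ((FormalCoproduct.incl ((ι → C) ⥤ C)).obj (s.functor C) ⟶ s.ev (generic C ι))
  | .unit => 𝟙 _
  | .var i => ⟨fun _ => i, fun _ => 𝟙 _⟩
  | .tensor s t => FormalCoproduct.pair (summand s) (summand t)

instance (s : Word ι) : IsIso ((summand C s).φ ⟨⟩) := by
  induction s with
  | unit => exact inferInstanceAs (IsIso (𝟙 _))
  | var i => exact inferInstanceAs (IsIso (𝟙 _))
  | tensor s t hs ht =>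
    exact inferInstanceAs (IsIso ((summand C s).φ ⟨⟩ ⊗ₘ (summand C t).φ ⟨⟩))

variable [BraidedCategory C]

/-- The inclusions of summands are natural with respect to formal structural isomorphisms. -/
theorem map_natIso_comp_summand {s t : Word ι} (f : Struct s t) :
    (FormalCoproduct.incl _).map (f.natIso C).hom ≫ summand C t =
      summand C s ≫ (f.ev (generic C ι)).hom := by
  induction f with
  | id s => exact (Category.id_comp _).trans (Category.comp_id _).symm
  | comp f g hf hg => simp only [Struct.natIso, Struct.ev, Iso.trans_hom, Functor.map_comp,
      Category.assoc, hg, reassoc_of% hf]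
  | inv f hf =>
    simp only [Struct.natIso, Struct.ev, Iso.symm_hom]
    rw [Iso.eq_comp_inv, Category.assoc, ← hf, ← Functor.map_comp_assoc, Iso.inv_hom_id,
      CategoryTheory.Functor.map_id, Category.id_comp]
  | tensor f g hf hg =>
    refine (FormalCoproduct.map_comp_pair ..).trans ?_
    rw [hf, hg]
    exact (FormalCoproduct.pair_comp ..).symm
  | assoc s t u =>
    exact FormalCoproduct.hom_mk_congr fun _ => (associator_naturality _ _ _).symm
  | leftUnitor s =>
    exact FormalCoproduct.hom_mk_congr fun _ =>
      ((congrArg (· ≫ _) (id_tensorHom _ _)).trans (leftUnitor_naturality _)).symm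
  | rightUnitor s =>
    exact FormalCoproduct.hom_mk_congr fun _ =>
      ((congrArg (· ≫ _) (tensorHom_id _ _)).trans (rightUnitor_naturality _)).symm
  | braiding s t =>
    exact FormalCoproduct.hom_mk_congr fun _ => (BraidedCategory.braiding_naturality _ _).symm

/-- Equality of the values at the formal coproduct of the variables implies equality of the natural
isomorphisms in all variables. -/
theorem natIso_eq_of_ev_eq {s t : Word ι} {f g : Struct s t}
    (h : f.ev (generic C ι) = g.ev (generic C ι)) : f.natIso C = g.natIso C := by
  refine Iso.ext (FormalCoproduct.map_comp_cancel (summand C t) ?_)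
  rw [map_natIso_comp_summand, map_natIso_comp_summand, h]

end

/-! ### The kernel of the map from the braid group to the symmetric group -/

namespace BraidGroup

/-- The product `s 0 * s 1 * ⋯ * s (k - 1)`. -/
def run {G : Type*} [Monoid G] (s : ℕ → G) : ℕ → G
  | 0 => 1
  | k + 1 => run s k * s k

section
variable {G : Type*} [Monoid G] {s : ℕ → G}

theorem run_mul_comm (hcomm : ∀ i j, i + 2 ≤ j → s i * s j = s j * s i) {i k : ℕ} (h : k < i) :
    run s k * s i = s i * run s k := by
  induction k with
  | zero => simp [run]
  | succ k ih => rw [run, mul_assoc, hcomm k i h, ← mul_assoc, ih (by omega), mul_assoc]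

/-- Moving `s i` to the left past `run s k` raises its index, by one braid relation. -/
theorem run_mul_shift (hcomm : ∀ i j, i + 2 ≤ j → s i * s j = s j * s i) {i k : ℕ} (h : i + 1 < k)
    (hbraid : s i * s (i + 1) * s i = s (i + 1) * s i * s (i + 1)) :
    run s k * s i = s (i + 1) * run s k := by
  induction k, h using Nat.le_induction with
  | base =>
    simp only [run, mul_assoc] at hbraid ⊢
    rw [hbraid, ← mul_assoc, run_mul_comm hcomm i.lt_succ_self, mul_assoc]
  | succ k hk ih => rw [run, mul_assoc, ← hcomm i k hk, ← mul_assoc, ih, mul_assoc]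

end

/-- The generator `σ_i` if there is one of this index, and `1` otherwise. -/
def σ' (n i : ℕ) : BraidGroup n := if h : i < n - 1 then σ ⟨i, h⟩ else 1

theorem σ'_comm (n i j : ℕ) (h : i + 2 ≤ j) : σ' n i * σ' n j = σ' n j * σ' n i := by
  unfold σ'
  split_ifs
  · exact σ_comm _ _ h
  all_goals simp

theorem σ'_braid (n i : ℕ) (h : i + 1 < n - 1) :
    σ' n i * σ' n (i + 1) * σ' n i = σ' n (i + 1) * σ' n i * σ' n (i + 1) := by
  rw [σ', σ', dif_pos h, dif_pos (by omega)]
  exact σ_braid _ _ rfl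

theorem place_one_σ' (n i : ℕ) (h : i < n - 1) (hn : 1 + n ≤ n + 1) :
    place 1 n (n + 1) hn (σ' n i) = σ' (n + 1) (i + 1) := by
  rw [σ', σ', dif_pos h, dif_pos (by omega), place_σ]
  exact congrArg σ (Fin.ext (Nat.add_comm 1 i))

/-- The normal subgroup generated by the squares of the generators. -/
def squares (n : ℕ) : Subgroup (BraidGroup n) :=
  Subgroup.normalClosure (Set.range fun i => σ i * σ i)

instance (n : ℕ) : (squares n).Normal := Subgroup.normalClosure_normal

theorem σ_mul_self_mem (n : ℕ) (i : Fin (n - 1)) : σ i * σ i ∈ squares n :=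
  Subgroup.subset_normalClosure ⟨i, rfl⟩

theorem place_mem_squares {k m n : ℕ} (h : k + m ≤ n) {x : BraidGroup m} (hx : x ∈ squares m) :
    place k m n h x ∈ squares n := by
  have : squares m ≤ (squares n).comap (place k m n h) := by
    refine Subgroup.normalClosure_le_normal ?_
    rintro _ ⟨i, rfl⟩
    change place k m n h (σ i * σ i) ∈ squares n
    rw [map_mul, place_σ]
    exact σ_mul_self_mem n _
  exact this hx

/-- Modulo the squares of the generators, every braid on `n + 1` strands is a braid on the last `n`
strands followed by `σ_0 σ_1 ⋯ σ_{k-1}`. -/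
theorem exists_normalForm {n : ℕ} (x : BraidGroup (n + 1)) :
    ∃ (y : BraidGroup n) (k : ℕ), k ≤ n ∧
      QuotientGroup.mk' (squares (n + 1)) x =
        QuotientGroup.mk' (squares (n + 1))
          (place 1 n (n + 1) (Nat.add_comm 1 n).le y * run (σ' (n + 1)) k) := by
  set π := QuotientGroup.mk' (squares (n + 1)) with hπ
  have hsq (i : ℕ) : π (σ' (n + 1) i) * π (σ' (n + 1) i) = 1 := by
    rw [← map_mul, hπ, QuotientGroup.mk'_apply, QuotientGroup.eq_one_iff, σ']
    split_ifs
    · exact σ_mul_self_mem _ _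
    · simp
  -- The set of normal forms is stable under multiplication by a generator on the right.
  have key (q : BraidGroup (n + 1) ⧸ squares (n + 1)) (i : ℕ) (hi : i < n)
      (hq : ∃ (y : BraidGroup n) (k : ℕ), k ≤ n ∧
        q = π (place 1 n (n + 1) (Nat.add_comm 1 n).le y * run (σ' (n + 1)) k)) :
      ∃ (y : BraidGroup n) (k : ℕ), k ≤ n ∧ q * π (σ' (n + 1) i) =
        π (place 1 n (n + 1) (Nat.add_comm 1 n).le y * run (σ' (n + 1)) k) := by
    obtain ⟨y, k, hk, rfl⟩ := hq
    -- With `ρ` for `run (σ' (n + 1)) k`: if `i + 1 = k`, then `σ_i` cancels the last factor of `ρ`;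
    -- if `i = k`, it prolongs `ρ`; and otherwise `ρ * σ_i = σ_j * ρ` with `j = i + 1` for
    -- `i + 1 < k` and `j = i` for `k < i`, where `σ_j` comes from a braid on the last `n` strands.
    rcases lt_trichotomy i k with h | rfl | h
    · obtain rfl | h' : i + 1 = k ∨ i + 1 < k := by omega
      · refine ⟨y, i, by omega, ?_⟩
        simp only [run, map_mul, mul_assoc, hsq, mul_one]
      · refine ⟨y * σ' n i, k, hk, ?_⟩
        rw [← map_mul, mul_assoc, run_mul_shift (σ'_comm _) h' (σ'_braid _ _ (by omega)),
          map_mul (place _ _ _ _), place_one_σ' _ _ (by omega), mul_assoc]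
    · refine ⟨y, i + 1, hi, ?_⟩
      rw [← map_mul, run, mul_assoc]
    · obtain ⟨i, rfl⟩ := Nat.exists_eq_add_of_le' (show 1 ≤ i by omega)
      refine ⟨y * σ' n i, k, hk, ?_⟩
      rw [← map_mul, mul_assoc, run_mul_comm (σ'_comm _) h,
          map_mul (place _ _ _ _), place_one_σ' _ _ (by omega), mul_assoc]
  have hx : x ∈ Subgroup.closure (Set.range (PresentedGroup.of (rels := artinRels (n + 1)))) := by
    rw [PresentedGroup.closure_range_of]; trivial
  induction hx using Subgroup.closure_induction_right with
  | one => exact ⟨1, 0, Nat.zero_le n, by simp [run]⟩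
  | mul_right x _ y hy ih =>
    obtain ⟨i, rfl⟩ := hy
    have : PresentedGroup.of i = σ' (n + 1) i := by
      rw [σ', dif_pos i.isLt]; rfl
    rw [map_mul, this]
    exact key _ i i.isLt ih
  | mul_inv_cancel x _ y hy ih =>
    obtain ⟨i, rfl⟩ := hy
    have : PresentedGroup.of i = σ' (n + 1) i := by
      rw [σ', dif_pos i.isLt]; rfl
    rw [map_mul, map_inv, this, inv_eq_of_mul_eq_one_right (hsq i)]
    exact key _ i i.isLt ih

end BraidGroup

namespace Word
open BraidGroup

/-- In a symmetric category the square of the braiding is the identity, so the subgroup `squares n`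
acts trivially. -/
theorem act_eq_refl_of_mem_squares {E : Type u} [Category.{v} E] [MonoidalCategory E]
    [SymmetricCategory E] (Y : E) {n : ℕ} {x : BraidGroup n} (hx : x ∈ squares n) :
    act Y x = Iso.refl _ := by
  have hswap (i n : ℕ) : (swapAt Y i n).hom ≫ (swapAt Y i n).hom = 𝟙 _ := by
    induction i generalizing n with
    | zero =>
      match n with
      | 0 => exact Category.comp_id _
      | 1 => exact Category.comp_id _
      | n + 2 =>
        change (frontSwap Y (ev Y (pow n))).hom ≫ (frontSwap Y (ev Y (pow n))).hom = 𝟙 _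
        simp [frontSwap, ← comp_whiskerRight_assoc]
    | succ i ih =>
      match n with
      | 0 => exact Category.comp_id _
      | n + 1 =>
        change Y ◁ (swapAt Y i n).hom ≫ Y ◁ (swapAt Y i n).hom = 𝟙 (Y ⊗ ev Y (pow n))
        rw [← whiskerLeft_comp, ih, whiskerLeft_id]
  have : squares n ≤ (actHom Y n).ker := by
    refine Subgroup.normalClosure_le_normal ?_
    rintro _ ⟨i, rfl⟩
    refine MulOpposite.unop_injective (Iso.ext ?_)
    change (act Y (σ i * σ i)).hom = 𝟙 _
    rw [act_mul, act_σ]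
    exact hswap i n
  exact congrArg (fun x : (Aut (ev Y (pow n)))ᵐᵒᵖ => x.unop) (this hx)

/-- The action of a braid on lists of booleans. -/
def actBool {n : ℕ} (x : BraidGroup n) (l : ev (E := Type) Bool (pow n)) :
    ev (E := Type) Bool (pow n) :=
  (act (E := Type) Bool x).hom l

theorem actBool_one {n : ℕ} (l : ev (E := Type) Bool (pow n)) :
    actBool (1 : BraidGroup n) l = l := by
  rw [actBool, act_one]; rfl

theorem actBool_mul {n : ℕ} (x y : BraidGroup n) (l : ev (E := Type) Bool (pow n)) :
    actBool (x * y) l = actBool y (actBool x l) := by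
  rw [actBool, act_mul]; rfl

theorem actBool_inv_eq {n : ℕ} (x : BraidGroup n) {l l' : ev (E := Type) Bool (pow n)}
    (h : actBool x l = l') : actBool x⁻¹ l' = l := by
  rw [← h, ← actBool_mul, mul_inv_cancel, actBool_one]

theorem actBool_place_one {n : ℕ} (h : 1 + n ≤ n + 1) (x : BraidGroup n) (b : Bool)
    (l : ev (E := Type) Bool (pow n)) :
    actBool (n := n + 1) (place 1 n (n + 1) h x) (b, l) = (b, actBool x l) := by
  induction x using BraidGroup.induction generalizing l with
  | one => rw [map_one, actBool_one, actBool_one]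
  | gen i =>
    rw [place_σ, actBool, act_σ, actBool, act_σ]
    simp only [Nat.add_comm 1]
    rfl
  | mul x y hx hy => rw [map_mul, actBool_mul, hx, hy, actBool_mul]
  | inv x hx =>
    rw [map_inv]
    refine actBool_inv_eq _ ?_
    rw [hx, ← actBool_mul, inv_mul_cancel, actBool_one]

/-- The list of `n` times `false`. -/
def falses : (n : ℕ) → ev (E := Type) Bool (pow n)
  | 0 => PUnit.unit
  | n + 1 => (false, falses n)

theorem actBool_falses {n : ℕ} (x : BraidGroup n) : actBool x (falses n) = falses n := by
  have h (i n : ℕ) : (swapAt (E := Type) Bool i n).hom (falses n) = falses n := by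
    induction i generalizing n with
    | zero =>
      match n with
      | 0 => rfl
      | 1 => rfl
      | n + 2 => rfl
    | succ i ih =>
      match n with
      | 0 => rfl
      | n + 1 => exact congrArg (Prod.mk false) (ih n)
  induction x using BraidGroup.induction with
  | one => exact actBool_one _
  | gen i => rw [actBool, act_σ]; exact h i n
  | mul x y hx hy => rw [actBool_mul, hx, hy]
  | inv x hx => exact actBool_inv_eq _ hx

/-- The braid `σ_0 σ_1 ⋯ σ_k` moves the letter `true` away from the front: `σ_0` does so, and the
later generators do not touch the front. -/
theorem actBool_run_fst {n k : ℕ} (hk : k + 1 ≤ n) :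
    Prod.fst (α := Bool) (β := ev (E := Type) Bool (pow n))
      (actBool (n := n + 1) (run (σ' (n + 1)) (k + 1)) (true, falses n)) = false := by
  obtain ⟨n, rfl⟩ := Nat.exists_eq_add_of_le' (show 1 ≤ n by omega)
  induction k with
  | zero =>
    rw [run, run, one_mul, σ', dif_pos (by omega), actBool, act_σ]
    rfl
  | succ k ih =>
    rw [run, actBool_mul, σ', dif_pos (by omega), actBool, act_σ]
    exact ih (by omega)

/-- A braid that permutes lists of booleans trivially lies in the normal subgroup generated by the
squares of the generators. This amounts to the presentation of the symmetric group that adds the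
relations `σ_i ^ 2 = 1` to those of Artin. -/
theorem mem_squares_of_actBool {n : ℕ} (x : BraidGroup n) (h : ∀ l, actBool x l = l) :
    x ∈ squares n := by
  induction n with
  | zero =>
    clear h
    induction x using BraidGroup.induction with
    | one => exact one_mem _
    | gen i => exact i.elim0
    | mul x y hx hy => exact mul_mem hx hy
    | inv x hx => exact inv_mem hx
  | succ n ih =>
    obtain ⟨y, k, hk, hx⟩ := exists_normalForm x
    have hx' := QuotientGroup.eq.mp hx
    have hact (l : ev (E := Type) Bool (pow (n + 1))) :
        actBool (run (σ' (n + 1)) k) (actBool (place 1 n (n + 1) (Nat.add_comm 1 n).le y) l) = l := by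
      have h₁ : actBool (x⁻¹ * (place 1 n (n + 1) (Nat.add_comm 1 n).le y * run (σ' (n + 1)) k)) l
          = l := by
        rw [actBool, act_eq_refl_of_mem_squares _ hx']; rfl
      rwa [actBool_mul, actBool_inv_eq x (h l), actBool_mul] at h₁
    -- If `k` were positive, the only `true` of `(true, falses n)` would leave the front.
    have hk0 : k = 0 := by
      by_contra hk0
      obtain ⟨k, rfl⟩ := Nat.exists_eq_add_of_le' (show 1 ≤ k by omega)
      have h₁ := hact (true, falses n)
      rw [actBool_place_one, actBool_falses] at h₁
      have h₂ := actBool_run_fst hk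
      rw [h₁] at h₂
      exact Bool.noConfusion h₂
    subst hk0
    have hy : y ∈ squares n := ih y fun l => by
      have h₁ := hact (true, l)
      rw [run, actBool_one, actBool_place_one] at h₁
      exact congrArg Prod.snd h₁
    rw [run, mul_one] at hx'
    have := mul_mem hx' (inv_mem (place_mem_squares (Nat.add_comm 1 n).le hy))
    rw [mul_inv_cancel_right] at this
    exact inv_mem_iff.mp this

/-- Two braids that act equally on the powers of `Bool` in the category of types act equally on the
powers of every object of every symmetric category. -/
theorem act_eq_of_act_type_eq {E : Type u} [Category.{v} E] [MonoidalCategory E]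
    [SymmetricCategory E] (Y : E) {n : ℕ} {x y : BraidGroup n}
    (h : act (E := Type) Bool x = act (E := Type) Bool y) : act Y x = act Y y := by
  have hxy : x * y⁻¹ ∈ squares n := mem_squares_of_actBool _ fun l => by
    rw [actBool_mul]
    exact actBool_inv_eq y (by rw [actBool, ← h]; rfl)
  have := act_eq_refl_of_mem_squares Y hxy
  rw [← inv_mul_cancel_right x y, act_mul, this, Iso.refl_trans]

variable {ι : Type*}

/-- The family of letters of an element of a product of copies of `Bool`, indexed by the occurrences
of variables in the word that brackets the product. -/
def coords : (s : Word ι) → s.ev (E := Type) Bool → s.Pos → Bool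
  | unit, _ => Empty.elim
  | var _, b => fun _ => b
  | tensor s t, p => Sum.elim (coords s p.1) (coords t p.2)

theorem coords_injective (s : Word ι) : Function.Injective s.coords := by
  induction s with
  | unit => intro _ _ _; rfl
  | var i => intro p q h; exact congrFun h ()
  | tensor s t hs ht =>
    intro p q h
    exact Prod.ext (hs (funext fun x => congrFun h (.inl x)))
      (ht (funext fun x => congrFun h (.inr x)))

end Word

namespace Struct
variable {ι : Type*}

/-- On products of copies of `Bool`, a formal structural isomorphism permutes the letters by its
underlying permutation. -/
theorem coords_perm {s t : Word ι} (f : Struct s t) (l : s.ev (E := Type) Bool) (x : s.Pos) :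
    t.coords ((f.ev (E := Type) Bool).hom l) (f.perm x) = s.coords l x := by
  induction f with
  | id s => rfl
  | comp f g hf hg => exact (hg _ _).trans (hf _ _)
  | @inv s t f hf =>
    have h := hf ((f.ev (E := Type) Bool).inv l) (f.perm.symm x)
    have e : (f.ev (E := Type) Bool).hom ((f.ev (E := Type) Bool).inv l) = l :=
      congrArg (fun φ : t.ev (E := Type) Bool ⟶ t.ev (E := Type) Bool => φ l)
        (f.ev (E := Type) Bool).inv_hom_id
    rw [e, Equiv.apply_symm_apply] at h
    exact h.symm
  | tensor f g hf hg =>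
    rcases x with x | x
    · exact hf l.1 x
    · exact hg l.2 x
  | assoc s t u => rcases x with (x | x) | x <;> rfl
  | leftUnitor s => rcases x with x | x <;> [exact x.elim; rfl]
  | rightUnitor s => rcases x with x | x <;> [rfl; exact x.elim]
  | braiding s t => rcases x with x | x <;> rfl

theorem ev_type_eq_of_perm_eq {s t : Word ι} {f g : Struct s t} (h : f.perm = g.perm) :
    f.ev (E := Type) Bool = g.ev (E := Type) Bool := by
  refine Iso.ext (ConcreteCategory.hom_ext _ _ fun l => t.coords_injective (funext fun x => ?_))
  obtain ⟨x, rfl⟩ := f.perm.surjective x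
  rw [coords_perm, h, coords_perm]

variable {E : Type u} [Category.{v} E] [MonoidalCategory E]

theorem ev_eq_of_act_eq [BraidedCategory E] (Y : E) {s t : Word ι} {f g : Struct s t}
    (h : Word.act Y f.braid = Word.act Y g.braid) : f.ev Y = g.ev Y := by
  obtain ⟨_, _, hf⟩ := f.represents_braidAt Y _ rfl
  obtain ⟨_, _, hg⟩ := g.represents_braidAt Y _ rfl
  refine Iso.ext (hf.trans (Eq.trans ?_ hg.symm))
  exact congrArg (fun e => _ ≫ Iso.hom e ≫ _) h

theorem act_braid_eq_of_ev_eq [BraidedCategory E] (Y : E) {s t : Word ι} {f g : Struct s t}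
    (h : f.ev Y = g.ev Y) : Word.act Y f.braid = Word.act Y g.braid := by
  obtain ⟨_, _, hf⟩ := f.represents_braidAt Y _ rfl
  obtain ⟨_, _, hg⟩ := g.represents_braidAt Y _ rfl
  rw [h, hg] at hf
  exact Iso.ext ((cancel_mono _).mp ((cancel_epi _).mp hf.symm))

theorem ev_eq_of_braid_eq [BraidedCategory E] (Y : E) {s t : Word ι} {f g : Struct s t}
    (h : f.braid = g.braid) : f.ev Y = g.ev Y :=
  ev_eq_of_act_eq Y (congrArg _ h)

theorem ev_eq_of_perm_eq [SymmetricCategory E] (Y : E) {s t : Word ι} {f g : Struct s t}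
    (h : f.perm = g.perm) : f.ev Y = g.ev Y :=
  ev_eq_of_act_eq Y (Word.act_eq_of_act_type_eq Y
    (act_braid_eq_of_ev_eq _ (ev_type_eq_of_perm_eq h)))

end Struct

end BraidCoherence

theorem mainTheorem2 :
    (∀ (C : Type*) [Category C] [MonoidalCategory C] [BraidedCategory C] (ι : Type*)
      (s t : BraidCoherence.Word ι) (f g : BraidCoherence.Struct s t),
      f.braid = g.braid → f.natIso C = g.natIso C) ∧
    (∀ (C : Type*) [Category C] [MonoidalCategory C] [SymmetricCategory C] (ι : Type*)
      (s t : BraidCoherence.Word ι) (f g : BraidCoherence.Struct s t),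
      f.perm = g.perm → f.natIso C = g.natIso C) :=
  ⟨fun C _ _ _ _ _ _ _ _ h =>
      BraidCoherence.natIso_eq_of_ev_eq C (BraidCoherence.Struct.ev_eq_of_braid_eq _ h),
    fun C _ _ _ _ _ _ _ _ h =>
      BraidCoherence.natIso_eq_of_ev_eq C (BraidCoherence.Struct.ev_eq_of_perm_eq _ h)⟩
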